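/- There are absolute constants $c>0$ and $\Delta$ and a univariate polynomial $p$ such that the following holds. Let $d, d_1, d_2$ be non-negative integers with $d_1, d_2 \le d$, and let $\mathbb{F}$ be any field (of any characteristic, finite or infinite) with at least $d^c$ elements. Then there is a division-free algebraic circuit $C$ over $\mathbb{F}$ (a directed acyclic graph whose leaves are input variables or constants from $\mathbb{F}$ and whose inner gates are sums and products of unbounded fan-in) with $d_1+d_2$ input variables $a_0,\dots,a_{d_1-1},b_0,\dots,b_{d_2-1}$, of size (number of gates plus number of wires) at most $p(d)$ and depth at most $\Delta$, which computes, as a formal polynomial in $\mathbb{F}[a_0,\dots,a_{d_1-1},b_0,\dots,b_{d_2-1}]$, the resultant with respect to $y$ of $$y^{d_1}+a_{d_1-1}y^{d_1-1}+\dots+a_0 \quad\text{and}\quad y^{d_2}+b_{d_2-1}y^{d_2-1}+\dots+b_0 .$$ In particular, for all monic $f,g\in\mathbb{F}[y]$ of degrees $d_1$ and $d_2$, the value of $C$ on the lists of non-leading coefficients of $f$ and $g$ is $\operatorname{Res}_y(f,g)$. Here the resultant is the determinant of the Sylvester matrix, with the sign normalized so that for monic $f$ and $g$ with roots (with multiplicity)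 $\sigma_1,\dots,\sigma_{d_1}$ and $\tau_1,\dots,\tau_{d_2}$ in an algebraic closure it equals $\prod_{i,j}(\sigma_i-\tau_j)$. -/

import Mathlib

universe u v w

/-- A gate of an algebraic circuit with constants in `F`, input variables indexed by `ι` and
children taken from `ν`: an input variable, a constant of `F`, or a sum or product gate of
arbitrary (unbounded) fan-in. A child occurring several times in the list is joined to the gate by
several wires. -/
inductive AlgGate (F : Type u) (ι : Type v) (ν : Type w) : Type (max u v w) where
  | var (i : ι) : AlgGate F ι ν
  | const (a : F) : AlgGate F ι ν
  | add (children : List ν) : AlgGate F ι ν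
  | mul (children : List ν) : AlgGate F ι ν

/-- The number of wires entering a gate. -/
def AlgGate.fanIn {F : Type u} {ι : Type v} {ν : Type w} : AlgGate F ι ν → ℕ
  | .var _ => 0
  | .const _ => 0
  | .add l => l.length
  | .mul l => l.length

/-- A (division-free) algebraic circuit over `F` with inputs indexed by `ι`: a finite directed
acyclic graph of gates, listed in a topological order (the children of gate `k` are gates with
index `< k`), with a designated output gate. -/
structure AlgCircuit (F : Type u) (ι : Type v) where
  numGates : ℕ
  gate : (k : Fin numGates) → AlgGate F ι (Fin (k : ℕ))
  output : Fin numGates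

namespace AlgCircuit

/-- The value of gate `k` on the input `x`, in any commutative `F`-algebra `A`. -/
def gateValue {F : Type u} {ι : Type v} [CommSemiring F] (C : AlgCircuit F ι)
    {A : Type w} [CommSemiring A] [Algebra F A] (x : ι → A) (k : Fin C.numGates) : A :=
  match C.gate k with
  | .var i => x i
  | .const a => algebraMap F A a
  | .add l => (l.map fun j => C.gateValue x ⟨j.1, j.2.trans k.2⟩).sum
  | .mul l => (l.map fun j => C.gateValue x ⟨j.1, j.2.trans k.2⟩).prod
termination_by k.1
decreasing_by all_goals exact j.2

/-- The output of the circuit on the input `x`, in any commutative `F`-algebra `A`. -/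
def eval {F : Type u} {ι : Type v} [CommSemiring F] (C : AlgCircuit F ι)
    {A : Type w} [CommSemiring A] [Algebra F A] (x : ι → A) : A :=
  C.gateValue x C.output

/-- The formal polynomial computed by the circuit. -/
noncomputable def toMvPolynomial {F : Type u} {ι : Type v} [CommSemiring F]
    (C : AlgCircuit F ι) : MvPolynomial ι F :=
  C.eval (fun i => (MvPolynomial.X i : MvPolynomial ι F))

/-- The depth of gate `k`: the number of wires on a longest path from a leaf to it (a sum or
product gate without children counts as having depth one). -/
def gateDepth {F : Type u} {ι : Type v} (C : AlgCircuit F ι) (k : Fin C.numGates) : ℕ :=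
  match C.gate k with
  | .var _ => 0
  | .const _ => 0
  | .add l => (l.map fun j => C.gateDepth ⟨j.1, j.2.trans k.2⟩).foldr max 0 + 1
  | .mul l => (l.map fun j => C.gateDepth ⟨j.1, j.2.trans k.2⟩).foldr max 0 + 1
termination_by k.1
decreasing_by all_goals exact j.2

/-- The depth of a circuit is the depth of its output gate. -/
def depth {F : Type u} {ι : Type v} (C : AlgCircuit F ι) : ℕ :=
  C.gateDepth C.output

/-- The size of a circuit: its number of gates (inputs and constants included) plus its number of
wires. -/
def size {F : Type u} {ι : Type v} (C : AlgCircuit F ι) : ℕ :=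
  C.numGates + ∑ k : Fin C.numGates, (C.gate k).fanIn

end AlgCircuit

/-- The monic polynomial `y ^ n + a (n - 1) y ^ (n - 1) + ⋯ + a 1 y + a 0`. -/
noncomputable def monicOfCoeffs {R : Type u} [CommRing R] {n : ℕ} (a : Fin n → R) :
    Polynomial R :=
  Polynomial.X ^ n + ∑ i : Fin n, Polynomial.C (a i) * Polynomial.X ^ (i : ℕ)

/-! Join `f` to a split polynomial by a line: pick distinct `α_i` in `F`, put `p = ∏ (X - α_i)`, `E
= f - p`, `f_t = p + t E`. Modulo `t ^ M`, Hensel lifting gives `f_t` roots `α_i + ψ_i` with `ψ_i`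
nilpotent, so `Res(f_t, g) = ∏ g(α_i + ψ_i)`. As a residue of `g f_t' / f_t` at the lifted root,
each factor is an explicit truncated series in `t` (`exists_root_eval_eq_sum_coeff`); the only
inverses in it are of power series over `F`, whose coefficients are constants of the circuit.
`Res(f_t, g)` has degree at most `d₁ + d₂ < M` in `t`, so truncation loses nothing, and summing its
coefficients sets `t = 1` (`resultant_eq_sum_coeff_prod`).

What remains is extracting low-order coefficients of products of polynomially many series.
Truncating, evaluating at points of `F` and interpolating does this in constant depth
(`IsShallow.coeff_list_prod`), and no characteristic assumption enters. A constant-depth formula of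
polynomial fan-in is a circuit of polynomial size. -/

/-! ### Circuits: evaluation, depth and gluing -/

namespace AlgGate

variable {F : Type u} {ι : Type v} {ν : Type w}

/-- Rename the children of a gate. -/
def rename {μ : Type*} (r : ν → μ) : AlgGate F ι ν → AlgGate F ι μ
  | .var i => .var i
  | .const a => .const a
  | .add l => .add (l.map r)
  | .mul l => .mul (l.map r)

@[simp] lemma fanIn_rename {μ : Type*} (r : ν → μ) (g : AlgGate F ι ν) :
    (g.rename r).fanIn = g.fanIn := by
  cases g <;> simp [rename, fanIn]

/-- The value of a gate, given the values of its children. -/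
def value [CommSemiring F] {A : Type*} [CommSemiring A] [Algebra F A] (x : ι → A) (y : ν → A) :
    AlgGate F ι ν → A
  | .var i => x i
  | .const a => algebraMap F A a
  | .add l => (l.map y).sum
  | .mul l => (l.map y).prod

/-- The depth of a gate, given the depths of its children. -/
def height (y : ν → ℕ) : AlgGate F ι ν → ℕ
  | .var _ => 0
  | .const _ => 0
  | .add l => (l.map y).foldr max 0 + 1
  | .mul l => (l.map y).foldr max 0 + 1

lemma value_rename [CommSemiring F] {A : Type*} [CommSemiring A] [Algebra F A] {μ : Type*}
    (r : ν → μ) (x : ι → A) (y : μ → A) (g : AlgGate F ι ν) :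
    (g.rename r).value x y = g.value x (y ∘ r) := by
  cases g <;> simp [rename, value, Function.comp_def]

lemma height_rename {μ : Type*} (r : ν → μ) (y : μ → ℕ) (g : AlgGate F ι ν) :
    (g.rename r).height y = g.height (y ∘ r) := by
  cases g <;> simp [rename, height, Function.comp_def]

end AlgGate

namespace AlgCircuit

variable {F : Type u} {ι : Type v}

lemma gateValue_eq [CommSemiring F] (C : AlgCircuit F ι) {A : Type w} [CommSemiring A]
    [Algebra F A] (x : ι → A) (k : Fin C.numGates) :
    C.gateValue x k = (C.gate k).value x fun j => C.gateValue x ⟨j.1, j.2.trans k.2⟩ := by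
  rw [gateValue]
  cases C.gate k <;> rfl

lemma gateDepth_eq (C : AlgCircuit F ι) (k : Fin C.numGates) :
    C.gateDepth k = (C.gate k).height fun j => C.gateDepth ⟨j.1, j.2.trans k.2⟩ := by
  rw [gateDepth]
  cases C.gate k <;> rfl

lemma map_gateValue [CommSemiring F] (C : AlgCircuit F ι) {A B : Type*} [CommSemiring A]
    [Algebra F A] [CommSemiring B] [Algebra F B] (φ : A →ₐ[F] B) (x : ι → A)
    (k : Fin C.numGates) : φ (C.gateValue x k) = C.gateValue (fun i => φ (x i)) k := by
  obtain ⟨k, hk⟩ := k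
  induction k using Nat.strong_induction_on with
  | _ k ih =>
    rw [gateValue_eq, gateValue_eq]
    cases C.gate ⟨k, hk⟩ with
    | var i => rfl
    | const a => simp [AlgGate.value]
    | add l =>
      simp only [AlgGate.value, map_list_sum, List.map_map]
      congr 1
      exact List.map_congr_left fun j _ => ih j.1 j.2 _
    | mul l =>
      simp only [AlgGate.value, map_list_prod, List.map_map]
      congr 1
      exact List.map_congr_left fun j _ => ih j.1 j.2 _

/-- Gates commute with algebra homomorphisms, so the formal identity determines every evaluation. -/
lemma eval_eq_aeval_toMvPolynomial [CommSemiring F] (C : AlgCircuit F ι) {A : Type*}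
    [CommSemiring A] [Algebra F A] (x : ι → A) :
    C.eval x = MvPolynomial.aeval x C.toMvPolynomial := by
  simp [eval, toMvPolynomial, map_gateValue]

/-- Add `m` further gates after those of `C`. -/
def extend (C : AlgCircuit F ι) (m : ℕ)
    (h : (k : Fin m) → AlgGate F ι (Fin (C.numGates + k))) (o : Fin (C.numGates + m)) :
    AlgCircuit F ι where
  numGates := C.numGates + m
  gate := Fin.addCases (motive := fun k => AlgGate F ι (Fin (k : ℕ))) (fun i => C.gate i)
    (fun j => h j)
  output := o

section extend

variable (C : AlgCircuit F ι) (m : ℕ)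
    (h : (k : Fin m) → AlgGate F ι (Fin (C.numGates + k))) (o : Fin (C.numGates + m))

/-- A gate of `C` as a gate of `C.extend m h o`. -/
def oldGate (k : Fin C.numGates) : Fin (C.extend m h o).numGates := Fin.castAdd m k

/-- An added gate as a gate of `C.extend m h o`. -/
def newGate (k : Fin m) : Fin (C.extend m h o).numGates := Fin.natAdd C.numGates k

lemma extend_gate_oldGate (k : Fin C.numGates) :
    (C.extend m h o).gate (C.oldGate m h o k) = C.gate k :=
  Fin.addCases_left (motive := fun k => AlgGate F ι (Fin (k : ℕ))) k

lemma extend_gate_newGate (k : Fin m) :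
    (C.extend m h o).gate (C.newGate m h o k) = h k :=
  Fin.addCases_right (motive := fun k => AlgGate F ι (Fin (k : ℕ))) k

lemma size_extend : (C.extend m h o).size = C.size + (m + ∑ k, (h k).fanIn) := by
  have : ∑ k, ((C.extend m h o).gate k).fanIn = ∑ k, (C.gate k).fanIn + ∑ k, (h k).fanIn :=
    (Fin.sum_univ_add (fun k => ((C.extend m h o).gate k).fanIn)).trans
      (congrArg₂ _
        (Finset.sum_congr rfl fun k _ => congrArg AlgGate.fanIn (C.extend_gate_oldGate m h o k))
        (Finset.sum_congr rfl fun k _ => congrArg AlgGate.fanIn (C.extend_gate_newGate m h o k)))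
  simp only [size, this]
  simp only [extend]
  omega

lemma gateValue_oldGate [CommSemiring F] {A : Type*} [CommSemiring A] [Algebra F A]
    (x : ι → A) (k : Fin C.numGates) :
    (C.extend m h o).gateValue x (C.oldGate m h o k) = C.gateValue x k := by
  obtain ⟨k, hk⟩ := k
  induction k using Nat.strong_induction_on with
  | _ k ih =>
    rw [gateValue_eq, gateValue_eq, extend_gate_oldGate]
    congr 1
    funext j
    exact ih j.1 j.2 _

lemma gateDepth_oldGate (k : Fin C.numGates) :
    (C.extend m h o).gateDepth (C.oldGate m h o k) = C.gateDepth k := by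
  obtain ⟨k, hk⟩ := k
  induction k using Nat.strong_induction_on with
  | _ k ih =>
    rw [gateDepth_eq, gateDepth_eq, extend_gate_oldGate]
    congr 1
    funext j
    exact ih j.1 j.2 _

end extend

/-- The disjoint union of two circuits. -/
def append (C D : AlgCircuit F ι) : AlgCircuit F ι :=
  C.extend D.numGates (fun k => (D.gate k).rename (Fin.natAdd C.numGates))
    (Fin.natAdd C.numGates D.output)

/-- A gate of `C` as a gate of `C.append D`. -/
def appendLeft (C D : AlgCircuit F ι) (k : Fin C.numGates) : Fin (C.append D).numGates :=
  C.oldGate _ _ _ k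

/-- A gate of `D` as a gate of `C.append D`. -/
def appendRight (C D : AlgCircuit F ι) (k : Fin D.numGates) : Fin (C.append D).numGates :=
  C.newGate _ _ _ k

lemma append_gate_appendRight (C D : AlgCircuit F ι) (k : Fin D.numGates) :
    (C.append D).gate (C.appendRight D k) = (D.gate k).rename (Fin.natAdd C.numGates) :=
  C.extend_gate_newGate _ _ _ k

lemma size_append (C D : AlgCircuit F ι) : (C.append D).size = C.size + D.size := by
  rw [append, size_extend]
  simp [size]

lemma gateValue_appendRight [CommSemiring F] {A : Type*} [CommSemiring A] [Algebra F A]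
    (C D : AlgCircuit F ι) (x : ι → A) (k : Fin D.numGates) :
    (C.append D).gateValue x (C.appendRight D k) = D.gateValue x k := by
  obtain ⟨k, hk⟩ := k
  induction k using Nat.strong_induction_on with
  | _ k ih =>
    rw [gateValue_eq, gateValue_eq, append_gate_appendRight]
    refine (AlgGate.value_rename _ _ _ _).trans ?_
    congr 1
    funext j
    exact ih j.1 j.2 _

lemma gateDepth_appendRight (C D : AlgCircuit F ι) (k : Fin D.numGates) :
    (C.append D).gateDepth (C.appendRight D k) = D.gateDepth k := by
  obtain ⟨k, hk⟩ := k
  induction k using Nat.strong_induction_on with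
  | _ k ih =>
    rw [gateDepth_eq, gateDepth_eq, append_gate_appendRight]
    refine (AlgGate.height_rename _ _ _).trans ?_
    congr 1
    funext j
    exact ih j.1 j.2 _

/-- Add one gate to `C` and make it the output. -/
def snoc (C : AlgCircuit F ι) (g : AlgGate F ι (Fin C.numGates)) : AlgCircuit F ι :=
  C.extend 1 (fun k => g.rename (Fin.castAdd k)) (Fin.natAdd C.numGates 0)

lemma size_snoc (C : AlgCircuit F ι) (g : AlgGate F ι (Fin C.numGates)) :
    (C.snoc g).size = C.size + (1 + g.fanIn) := by
  simp [snoc, size_extend]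

lemma eval_snoc [CommSemiring F] {A : Type*} [CommSemiring A] [Algebra F A]
    (C : AlgCircuit F ι) (g : AlgGate F ι (Fin C.numGates)) (x : ι → A) :
    (C.snoc g).eval x = g.value x (C.gateValue x) := by
  rw [eval, gateValue_eq]
  change AlgGate.value x _ ((C.extend 1 _ _).gate (C.newGate _ _ _ 0)) = _
  rw [extend_gate_newGate]
  refine (AlgGate.value_rename _ _ _ _).trans ?_
  congr 1
  funext j
  exact gateValue_oldGate _ _ _ _ _ _

lemma depth_snoc (C : AlgCircuit F ι) (g : AlgGate F ι (Fin C.numGates)) :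
    (C.snoc g).depth = g.height C.gateDepth := by
  rw [depth, gateDepth_eq]
  change AlgGate.height _ ((C.extend 1 _ _).gate (C.newGate _ _ _ 0)) = _
  rw [extend_gate_newGate]
  refine (AlgGate.height_rename _ _ _).trans ?_
  congr 1
  funext j
  exact gateDepth_oldGate _ _ _ _ _

/-- The circuit with a single gate, a leaf. -/
def leaf (g : AlgGate F ι (Fin 0)) : AlgCircuit F ι where
  numGates := 1
  gate := fun _ => g.rename Fin.elim0
  output := 0

/-- Circuits for the members of a list can be put into a common circuit. -/
lemma exists_common [CommSemiring F] {Δ s : ℕ} (l : List (MvPolynomial ι F))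
    (hl : ∀ P ∈ l, ∃ C : AlgCircuit F ι, C.size ≤ s ∧ C.depth ≤ Δ ∧ C.toMvPolynomial = P) :
    ∃ (C : AlgCircuit F ι) (o : List (Fin C.numGates)), C.size ≤ l.length * s + 1 ∧
      (∀ k ∈ o, C.gateDepth k ≤ Δ) ∧ o.map (C.gateValue MvPolynomial.X) = l := by
  induction l with
  | nil => exact ⟨leaf (.const 0), [], by simp [leaf, size, AlgGate.fanIn, AlgGate.rename], by simp, rfl⟩
  | cons P l ih =>
    obtain ⟨C, o, hs, hd, hv⟩ := ih fun Q hQ => hl Q (by simp [hQ])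
    obtain ⟨D, hDs, hDd, hDv⟩ := hl P (by simp)
    refine ⟨C.append D, C.appendRight D D.output :: o.map (C.appendLeft D), ?_, ?_,
      ?_⟩
    · rw [size_append, List.length_cons, add_mul]
      omega
    · simp only [List.mem_cons, List.mem_map, forall_eq_or_imp]
      refine ⟨(gateDepth_appendRight C D _).trans_le hDd, ?_⟩
      rintro _ ⟨k, hk, rfl⟩
      exact (gateDepth_oldGate _ _ _ _ _).trans_le (hd k hk)
    · rw [List.map_cons, List.map_map]
      congr 1
      · exact (gateValue_appendRight C D _ _).trans hDv
      · rw [← hv]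
        exact List.map_congr_left fun k _ => gateValue_oldGate _ _ _ _ _ _

end AlgCircuit

/-! ### Shallow formulas and their circuits -/

/-- The polynomials that have a formula of depth at most `Δ` with sum and product gates of
fan-in at most `N`. -/
inductive IsShallow {F : Type u} [CommSemiring F] {ι : Type v} (N : ℕ) :
    ℕ → MvPolynomial ι F → Prop
  | var (Δ : ℕ) (i : ι) : IsShallow N Δ (MvPolynomial.X i)
  | const (Δ : ℕ) (a : F) : IsShallow N Δ (MvPolynomial.C a)
  | sum {Δ : ℕ} {l : List (MvPolynomial ι F)} (hN : l.length ≤ N)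
      (hl : ∀ P ∈ l, IsShallow N Δ P) : IsShallow N (Δ + 1) l.sum
  | prod {Δ : ℕ} {l : List (MvPolynomial ι F)} (hN : l.length ≤ N)
      (hl : ∀ P ∈ l, IsShallow N Δ P) : IsShallow N (Δ + 1) l.prod

/-- A bound on the size of formulas of given depth and fan-in. -/
def shallowSize {R : Type*} [Semiring R] (N : R) : ℕ → R
  | 0 => 1
  | Δ + 1 => N * (shallowSize N Δ + 1) + 2

/-- The recursion read in `ℕ[X]` provides one polynomial bounding the size for all `d`. -/
lemma eval_shallowSize (q : Polynomial ℕ) (d Δ : ℕ) :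
    (shallowSize q Δ).eval d = shallowSize (q.eval d) Δ := by
  induction Δ with
  | zero => simp [shallowSize]
  | succ Δ ih => simp [shallowSize, ih]

lemma one_le_shallowSize (N Δ : ℕ) : 1 ≤ shallowSize N Δ := by
  cases Δ <;> simp [shallowSize]

namespace AlgCircuit

lemma foldr_max_le {l : List ℕ} {n : ℕ} (h : ∀ a ∈ l, a ≤ n) : l.foldr max 0 ≤ n := by
  induction l with
  | nil => simp
  | cons a l ih =>
    simp only [List.mem_cons, forall_eq_or_imp] at h
    exact max_le h.1 (ih h.2)

/-- Each child gets its own copy of a circuit, without sharing; for fixed depth the size stays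
polynomial in `N`. -/
lemma exists_of_isShallow {F : Type u} [CommSemiring F] {ι : Type v} {N Δ : ℕ}
    {P : MvPolynomial ι F} (hP : IsShallow N Δ P) :
    ∃ C : AlgCircuit F ι, C.size ≤ shallowSize N Δ ∧ C.depth ≤ Δ ∧ C.toMvPolynomial = P := by
  induction hP with
  | var Δ i =>
    refine ⟨leaf (.var i), ?_, ?_, ?_⟩
    · simpa [leaf, size, AlgGate.fanIn, AlgGate.rename] using one_le_shallowSize N Δ
    · rw [depth, gateDepth_eq]; simp [leaf, AlgGate.rename, AlgGate.height]
    · rw [toMvPolynomial, eval, gateValue_eq]; simp [leaf, AlgGate.rename, AlgGate.value]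
  | const Δ a =>
    refine ⟨leaf (.const a), ?_, ?_, ?_⟩
    · simpa [leaf, size, AlgGate.fanIn, AlgGate.rename] using one_le_shallowSize N Δ
    · rw [depth, gateDepth_eq]; simp [leaf, AlgGate.rename, AlgGate.height]
    · rw [toMvPolynomial, eval, gateValue_eq]
      simp [leaf, AlgGate.rename, AlgGate.value, MvPolynomial.algebraMap_eq]
  | @sum Δ l hN hl ih =>
    obtain ⟨C, o, hs, hd, rfl⟩ := exists_common l ih
    rw [List.length_map] at hs hN
    refine ⟨C.snoc (.add o), ?_, ?_, ?_⟩
    · rw [size_snoc]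
      simp only [AlgGate.fanIn, shallowSize]
      have := Nat.mul_le_mul_right (shallowSize N Δ + 1) hN
      nlinarith
    · rw [depth_snoc]
      exact Nat.succ_le_succ (foldr_max_le (by simpa using hd))
    · rw [toMvPolynomial, eval_snoc]; rfl
  | @prod Δ l hN hl ih =>
    obtain ⟨C, o, hs, hd, rfl⟩ := exists_common l ih
    rw [List.length_map] at hs hN
    refine ⟨C.snoc (.mul o), ?_, ?_, ?_⟩
    · rw [size_snoc]
      simp only [AlgGate.fanIn, shallowSize]
      have := Nat.mul_le_mul_right (shallowSize N Δ + 1) hN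
      nlinarith
    · rw [depth_snoc]
      exact Nat.succ_le_succ (foldr_max_le (by simpa using hd))
    · rw [toMvPolynomial, eval_snoc]; rfl

end AlgCircuit

/-! ### Closure properties and interpolation -/

namespace IsShallow

open MvPolynomial

variable {F : Type u} [Field F] {ι : Type v} {N Δ : ℕ}

lemma succ {P : MvPolynomial ι F} (h : IsShallow N Δ P) : IsShallow N (Δ + 1) P := by
  induction h with
  | var Δ i => exact .var _ i
  | const Δ a => exact .const _ a
  | sum hN _ ih => exact .sum hN ih
  | prod hN _ ih => exact .prod hN ih

lemma mono {Δ' : ℕ} (h : Δ ≤ Δ') {P : MvPolynomial ι F} (hP : IsShallow N Δ P) :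
    IsShallow N Δ' P := by
  induction h with
  | refl => exact hP
  | step _ ih => exact ih.succ

lemma finset_sum {κ : Type*} {s : Finset κ} (hs : s.card ≤ N) {P : κ → MvPolynomial ι F}
    (hP : ∀ i ∈ s, IsShallow N Δ (P i)) : IsShallow N (Δ + 1) (∑ i ∈ s, P i) := by
  rw [← Finset.sum_map_toList]
  exact .sum (by simpa using hs) (by simpa using hP)

lemma add (hN : 2 ≤ N) {P Q : MvPolynomial ι F} (hP : IsShallow N Δ P) (hQ : IsShallow N Δ Q) :
    IsShallow N (Δ + 1) (P + Q) := by
  have : IsShallow N (Δ + 1) [P, Q].sum := .sum hN (by simp [hP, hQ])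
  simpa using this

lemma C_mul (hN : 2 ≤ N) (a : F) {P : MvPolynomial ι F} (hP : IsShallow N Δ P) :
    IsShallow N (Δ + 1) (C a * P) := by
  have : IsShallow N (Δ + 1) [C a, P].prod := .prod hN (by simp [hP, IsShallow.const])
  simpa using this

lemma sum_C_mul (hN : 2 ≤ N) {κ : Type*} {s : Finset κ} (hs : s.card ≤ N) (a : κ → F)
    {P : κ → MvPolynomial ι F} (hP : ∀ i ∈ s, IsShallow N Δ (P i)) :
    IsShallow N (Δ + 2) (∑ i ∈ s, C (a i) * P i) :=
  finset_sum hs fun i hi => (hP i hi).C_mul hN _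

end IsShallow

/-- With nodes in `F` the Lagrange basis has coefficients in `F`, so interpolating over `A` needs no
division in `A`. -/
lemma Polynomial.eq_sum_C_eval_mul_basis {F A : Type*} [Field F] [CommRing A] [IsDomain A]
    [Algebra F A] {n : ℕ} (e : Fin n ↪ F) (Q : Polynomial A) (hQ : Q.degree < n) :
    Q = ∑ j, C (Q.eval (algebraMap F A (e j))) *
      (Lagrange.basis Finset.univ e j).map (algebraMap F A) := by
  refine eq_of_degrees_lt_of_eval_index_eq Finset.univ
    (v := fun j => algebraMap F A (e j)) (((algebraMap F A).injective.comp e.injective).injOn)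
    (by simpa using hQ) ?_ ?_
  · refine (degree_sum_le _ _).trans_lt ?_
    rw [Finset.sup_lt_iff (WithBot.bot_lt_coe _)]
    intro j _
    rw [← smul_eq_C_mul]
    refine (degree_smul_le _ _).trans_lt (degree_map_le.trans_lt ?_)
    rw [Lagrange.degree_basis e.injective.injOn (Finset.mem_univ j)]
    have := j.pos
    simp only [Finset.card_univ, Fintype.card_fin, Nat.cast_lt]
    omega
  · intro i _
    rw [eval_finsetSum, Finset.sum_eq_single i]
    · rw [eval_mul, eval_C, eval_map_algebraMap, aeval_algebraMap_apply, coe_aeval_eq_eval,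
        Lagrange.eval_basis_self e.injective.injOn (Finset.mem_univ i)]
      simp
    · intro j _ hj
      rw [eval_mul, eval_map_algebraMap, aeval_algebraMap_apply, coe_aeval_eq_eval,
        Lagrange.eval_basis_of_ne hj (Finset.mem_univ i)]
      simp
    · simp

lemma PowerSeries.coeff_list_prod_trunc {A : Type*} [CommRing A] {M : ℕ}
    (L : List (PowerSeries A)) {k : ℕ} (hk : k < M) :
    coeff k L.prod = (L.map (trunc M)).prod.coeff k := by
  induction L generalizing k with
  | nil => simp [coeff_one, Polynomial.coeff_one]
  | cons P L ih =>
    rw [List.prod_cons, List.map_cons, List.prod_cons, coeff_mul, Polynomial.coeff_mul]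
    refine Finset.sum_congr rfl fun x hx => ?_
    have := Finset.HasAntidiagonal.mem_antidiagonal.mp hx
    rw [ih (by omega), coeff_trunc, if_pos (by omega)]

namespace IsShallow

open MvPolynomial

variable {F : Type u} [Field F] {ι : Type v} {N Δ : ℕ}

/-- By interpolation a coefficient is an `F`-linear combination of `N` values: one layer of scalings
and one sum. -/
lemma coeff_of_eval (hN : 2 ≤ N) (e : Fin N ↪ F) {Q : Polynomial (MvPolynomial ι F)}
    (hQ : Q.degree < N) (h : ∀ a : F, IsShallow N Δ (Q.eval (C a))) (k : ℕ) :
    IsShallow N (Δ + 2) (Q.coeff k) := by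
  rw [Polynomial.eq_sum_C_eval_mul_basis e Q hQ, Polynomial.finsetSum_coeff]
  simp only [Polynomial.coeff_C_mul, Polynomial.coeff_map, algebraMap_eq, mul_comm _ (C _)]
  exact sum_C_mul hN (by simp) _ fun j _ => h _

/-- The low order coefficients of a product of power series can be found by interpolation. -/
lemma coeff_list_prod (hN : 2 ≤ N) (e : Fin N ↪ F) {M : ℕ} (hM : M ≤ N)
    (L : List (PowerSeries (MvPolynomial ι F))) (hL : L.length ≤ N) (hLM : L.length * M < N)
    (h : ∀ P ∈ L, ∀ k < M, IsShallow N Δ (PowerSeries.coeff k P)) (k : ℕ) (hk : k < M) :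
    IsShallow N (Δ + 5) (PowerSeries.coeff k L.prod) := by
  rw [PowerSeries.coeff_list_prod_trunc L hk]
  refine coeff_of_eval (Δ := Δ + 3) hN e ?_ (fun a => ?_) k
  · refine Polynomial.degree_le_natDegree.trans_lt (Nat.cast_lt.mpr ?_)
    refine (Polynomial.natDegree_list_prod_le _).trans_lt (lt_of_le_of_lt ?_ hLM)
    have := List.sum_le_card_nsmul ((L.map (PowerSeries.trunc M)).map Polynomial.natDegree) M (by
      simp only [List.map_map, List.mem_map, Function.comp_apply]
      rintro _ ⟨P, _, rfl⟩
      exact Polynomial.natDegree_le_of_degree_le (PowerSeries.degree_trunc_lt P M).le)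
    simpa using this
  · rw [Polynomial.eval_list_prod]
    refine .prod (by simpa using hL) ?_
    simp only [List.map_map, List.mem_map, Function.comp_apply]
    rintro _ ⟨P, hP, rfl⟩
    rw [Polynomial.eval, PowerSeries.eval₂_trunc_eq_sum_range]
    simp only [RingHom.id_apply, ← map_pow, mul_comm _ (C _)]
    exact sum_C_mul hN (by simpa using hM) _ fun k hk => h P hP k (Finset.mem_range.mp hk)

end IsShallow

/-! ### The residue formula at a nilpotent root -/

open Polynomial in
lemma PowerSeries.eval_eq_sum_range_of_pow_eq_zero {S : Type*} [CommRing S] (h : S[X]) {φ : S}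
    {M : ℕ} (hφ : φ ^ M = 0) : h.eval φ = ∑ k ∈ Finset.range M, h.coeff k * φ ^ k := by
  rw [eval_eq_sum_range' (n := M + (h.natDegree + 1)) (by omega), Finset.sum_range_add]
  simp [pow_add, hφ]

/-- A root of `X u + t E` near `0`, for nilpotent `t`, and a residue formula for the values of
polynomials at this root. -/
theorem Polynomial.exists_root_eval_eq_sum_coeff {S : Type*} [CommRing S] {t : S} {M : ℕ}
    (ht : t ^ M = 0) (u E : Polynomial S) (v : PowerSeries S) (huv : (u : PowerSeries S) * v = 1) :
    ∃ φ : S, IsNilpotent φ ∧ (X * u + C t * E).eval φ = 0 ∧ ∀ h : Polynomial S, h.eval φ =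
      ∑ m ∈ Finset.range M, (-t) ^ m * PowerSeries.coeff m
        ((h : PowerSeries S) * ((derivative (X * u + C t * E) : Polynomial S) : PowerSeries S)
          * (E : PowerSeries S) ^ m * v ^ (m + 1)) := by
  set f := X * u + C t * E with hf
  have htn : IsNilpotent t := ⟨M, ht⟩
  have hu0 : IsUnit (u.eval 0) := by
    have := congrArg PowerSeries.constantCoeff huv
    rw [map_mul, map_one, constantCoeff_coe, coeff_zero_eq_eval_zero] at this
    exact IsUnit.of_mul_eq_one _ this
  have hf0 : IsNilpotent (aeval (0 : S) f) := by
    simpa [hf] using (Commute.all t _).isNilpotent_mul_right htn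
  have hf0' : IsUnit (aeval (0 : S) (derivative f)) := by
    simpa [hf] using ((Commute.all t _).isNilpotent_mul_right htn).isUnit_add_left_of_commute hu0
      (Commute.all _ _)
  obtain ⟨φ, ⟨hφ, hfφ⟩, -⟩ := existsUnique_nilpotent_sub_and_aeval_eq_zero hf0 hf0'
  rw [zero_sub, isNilpotent_neg_iff] at hφ
  rw [coe_aeval_eq_eval] at hfφ
  obtain ⟨q, hq⟩ := dvd_iff_isRoot.mpr hfφ
  -- Here `q(φ) = f'(φ)`; unit values persist under nilpotent shifts, so `q(0)` is a unit too.
  have hqφ : IsUnit (q.eval φ) := by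
    have : IsUnit (aeval φ (derivative f)) :=
      isUnit_aeval_of_isUnit_aeval_of_isNilpotent_sub hf0' (by simpa using hφ)
    rw [hq] at this
    simpa using this
  have hq0 : IsUnit (q.eval 0) := by
    have := isUnit_aeval_of_isUnit_aeval_of_isNilpotent_sub (P := q) (a := 0) (b := φ)
      (by simpa [coe_aeval_eq_eval] using hqφ) (by simpa using hφ)
    simpa [coe_aeval_eq_eval] using this
  -- Comparing `f(0) = t E(0)` with `f(0) = -φ q(0)` shows that `φ` is a multiple of `t`.
  have hφM : φ ^ M = 0 := by
    obtain ⟨w, hw⟩ := hq0.exists_right_inv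
    have h1 : f.eval 0 = -φ * q.eval 0 := by rw [hq]; simp
    have h2 : f.eval 0 = t * E.eval 0 := by simp [hf]
    have : φ = t * (-E.eval 0 * w) := by linear_combination (-φ) * hw - w * (h1.symm.trans h2)
    rw [this, mul_pow, ht, zero_mul]
  obtain ⟨w, hw⟩ : ∃ w : PowerSeries S, (q : PowerSeries S) * w = 1 := by
    refine IsUnit.exists_right_inv (PowerSeries.isUnit_iff_constantCoeff.mpr ?_)
    rwa [constantCoeff_coe, coeff_zero_eq_eval_zero]
  refine ⟨φ, hφ, hfφ, fun h => ?_⟩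
  -- Partial sums of the geometric series for `X ^ M / (X u + t E)`, with `v = 1 / u`. The factor `X
  -- ^ M` clears the poles; the error in `hfA` telescopes and vanishes at `j = M`.
  let A : ℕ → PowerSeries S := fun j => ∑ m ∈ Finset.range j,
    (-PowerSeries.C t) ^ m * (E : PowerSeries S) ^ m * v ^ (m + 1) * PowerSeries.X ^ (M - 1 - m)
  have hfA : ∀ j ≤ M, (f : PowerSeries S) * A j = PowerSeries.X ^ M
      - (-PowerSeries.C t) ^ j * (E : PowerSeries S) ^ j * v ^ j * PowerSeries.X ^ (M - j) := by
    intro j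
    induction j with
    | zero => intro _; simp [A]
    | succ j ih =>
      intro hj
      have hX : (PowerSeries.X : PowerSeries S) ^ (M - j) =
          PowerSeries.X * PowerSeries.X ^ (M - 1 - j) := by
        rw [← pow_succ']; congr 1; omega
      have hfc : (f : PowerSeries S) = PowerSeries.X * (u : PowerSeries S) + PowerSeries.C t * (E : PowerSeries S) := by
        simp [hf]
      have hA : A (j + 1) = A j + (-PowerSeries.C t) ^ j * (E : PowerSeries S) ^ j * v ^ (j + 1)
          * PowerSeries.X ^ (M - 1 - j) := Finset.sum_range_succ _ _
      rw [hA, mul_add, ih (by omega), hX, hfc, show M - (j + 1) = M - 1 - j by omega]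
      linear_combination ((-PowerSeries.C t) ^ j * (E : PowerSeries S) ^ j * v ^ j
        * PowerSeries.X * PowerSeries.X ^ (M - 1 - j)) * huv
  have hfA : (f : PowerSeries S) * A M = PowerSeries.X ^ M := by
    rw [hfA M le_rfl, ← map_neg, ← map_pow, neg_pow, ht]; simp
  have hfq : (f : PowerSeries S) = (PowerSeries.X - PowerSeries.C φ) * (q : PowerSeries S) := by
    rw [hq]; simp [sub_eq_add_neg, ← map_neg]
  -- This is `X ^ M / (X - φ)`, a polynomial because `φ ^ M = 0`.
  let B : PowerSeries S := ∑ k ∈ Finset.range M,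
    PowerSeries.X ^ k * PowerSeries.C φ ^ (M - 1 - k)
  have hB : (PowerSeries.X - PowerSeries.C φ) * B = PowerSeries.X ^ M := by
    have := (Commute.all (PowerSeries.X : PowerSeries S) (PowerSeries.C φ)).mul_geom_sum₂ M
    rwa [← map_pow (PowerSeries.C) φ M, hφM, map_zero, sub_zero] at this
  have hqA : (q : PowerSeries S) * A M = B := by
    have h0 : (PowerSeries.X - PowerSeries.C φ) * ((q : PowerSeries S) * A M - B) = 0 := by
      linear_combination hfA - hB - A M * hfq
    -- `X - φ` is cancelled by multiplying it up to `X ^ M`, which is not a zero divisor.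
    have h1 : PowerSeries.X ^ M * ((q : PowerSeries S) * A M - B) = 0 := by
      rw [← hB, mul_right_comm, h0, zero_mul]
    refine sub_eq_zero.mp (PowerSeries.ext fun n => ?_)
    simpa using congrArg (PowerSeries.coeff (n + M)) h1
  have hf' : ((derivative f : Polynomial S) : PowerSeries S) =
      (q : PowerSeries S) + (PowerSeries.X - PowerSeries.C φ) * ((derivative q : Polynomial S) : PowerSeries S) := by
    rw [hq]; simp [sub_eq_add_neg, ← map_neg, add_comm]
  rcases Nat.eq_zero_or_pos M with rfl | hMpos
  · have : Subsingleton S := subsingleton_of_zero_eq_one (by simpa using ht.symm)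
    exact Subsingleton.elim _ _
  -- `f' / f = 1 / (X - φ) + q' / q`, multiplied by `h X ^ M`. The last term is divisible by `X ^
  -- M`, so it does not reach the residue, now the coefficient of `X ^ (M - 1)`.
  have key : (h : PowerSeries S) * ((derivative f : Polynomial S) : PowerSeries S) * A M =
      (h : PowerSeries S) * B + PowerSeries.X ^ M * ((h : PowerSeries S) * ((derivative q : Polynomial S) : PowerSeries S) * w) := by
    rw [hf', ← hqA, ← hfA, hfq]
    linear_combination (-((h : PowerSeries S) * ((derivative q : Polynomial S) : PowerSeries S)
      * (PowerSeries.X - PowerSeries.C φ) * A M)) * hw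
  have hl := (congrArg (PowerSeries.coeff (M - 1)) key).trans (map_add _ _ _)
  have hl1 : PowerSeries.coeff (M - 1) (PowerSeries.X ^ M * ((h : PowerSeries S) * ((derivative q : Polynomial S) : PowerSeries S) * w))
      = 0 := by
    rw [PowerSeries.coeff_X_pow_mul', if_neg (by omega)]
  have hl2 : PowerSeries.coeff (M - 1) ((h : PowerSeries S) * B) = h.eval φ := by
    rw [PowerSeries.eval_eq_sum_range_of_pow_eq_zero h hφM, ← Finset.sum_range_reflect,
      Finset.mul_sum, map_sum]
    refine Finset.sum_congr rfl fun k hk => ?_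
    have := Finset.mem_range.mp hk
    rw [← map_pow, mul_left_comm, PowerSeries.coeff_X_pow_mul', if_pos (by omega),
      PowerSeries.coeff_mul_C, coeff_coe]
  rw [hl1, hl2, add_zero] at hl
  rw [← hl, Finset.mul_sum, map_sum]
  refine Finset.sum_congr rfl fun m hm => ?_
  have := Finset.mem_range.mp hm
  rw [← map_neg, ← map_pow, show ∀ a b c d e f : PowerSeries S,
    a * b * (c * d * e * f) = f * (c * (a * b * d * e)) by intros; ring,
    PowerSeries.coeff_X_pow_mul', if_pos (by omega), PowerSeries.coeff_C_mul,
    show M - 1 - (M - 1 - m) = m by omega]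

/-! ### The resultant along the line from a split polynomial -/

namespace Polynomial

lemma taylor_prod_X_sub_C {S : Type*} [CommRing S] {n : ℕ} (β : Fin n → S) (i : Fin n) :
    taylor (β i) (∏ j, (X - C (β j))) =
      X * ∏ j ∈ Finset.univ.erase i, (X + C (β i - β j)) := by
  rw [taylor_apply, prod_comp, ← Finset.mul_prod_erase _ _ (Finset.mem_univ i)]
  congr 1
  · simp
  · exact Finset.prod_congr rfl fun j _ => by simp; ring

/-- The resultant of a nilpotent perturbation of a product of linear factors. -/
theorem resultant_prod_add_C_mul {S : Type*} [CommRing S] {t : S} {M n k : ℕ} (ht : t ^ M = 0)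
    (β : Fin n → S) (hβ : Pairwise fun i j => IsUnit (β i - β j)) (E g : S[X])
    (hE : E.degree < n) (hg : g.natDegree ≤ k) (v : Fin n → PowerSeries S)
    (hv : ∀ i, ((∏ j ∈ Finset.univ.erase i, (X + C (β i - β j)) : S[X]) : PowerSeries S) * v i = 1) :
    resultant (∏ j, (X - C (β j)) + C t * E) g n k = ∏ i, ∑ m ∈ Finset.range M,
      (-t) ^ m * PowerSeries.coeff m ((taylor (β i) g : PowerSeries S) *
        ((derivative (taylor (β i) (∏ j, (X - C (β j)) + C t * E)) : S[X]) : PowerSeries S) *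
        (taylor (β i) E : PowerSeries S) ^ m * v i ^ (m + 1)) := by
  nontriviality S
  set f := ∏ j, (X - C (β j)) + C t * E with hf
  have htf : ∀ i, taylor (β i) f =
      X * ∏ j ∈ Finset.univ.erase i, (X + C (β i - β j)) + C t * taylor (β i) E := fun i => by
    rw [hf, map_add, taylor_prod_X_sub_C, taylor_mul, taylor_C]
  choose ψ hψ hψf hψe using fun i =>
    exists_root_eval_eq_sum_coeff ht _ (taylor (β i) E) (v i) (hv i)
  simp only [← htf] at hψf hψe
  have hdeg : (∏ j, (X - C (β j)) : S[X]).degree = (n : WithBot ℕ) := by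
    rw [degree_prod_of_monic _ _ fun j _ => monic_X_sub_C (β j)]
    simp
  have hlt : (C t * E).degree < (∏ j, (X - C (β j))).degree := by
    rw [hdeg, ← smul_eq_C_mul]
    exact (degree_smul_le _ _).trans_lt hE
  have hfm : f.Monic := (monic_prod_X_sub_C _ _).add_of_left hlt
  have hfd : f.natDegree = n := by
    refine natDegree_eq_of_degree_eq_some ?_
    rw [hf, degree_add_eq_left_of_degree_lt hlt, hdeg]
  -- The lifted roots differ by a unit plus a nilpotent, so their linear factors are coprime even
  -- though `S` need not be a domain.
  have hdvd : ∏ j, (X - C (ψ j + β j)) ∣ f := by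
    refine Finset.prod_dvd_of_coprime (fun i _ j _ hij => ?_) fun i _ => ?_
    · refine isCoprime_X_sub_C_of_isUnit_sub ?_
      rw [add_sub_add_comm]
      exact ((Commute.all _ _).isNilpotent_sub (hψ i) (hψ j)).isUnit_add_right_of_commute
        (hβ hij) (Commute.all _ _)
    · rw [dvd_iff_isRoot, IsRoot.def, ← taylor_eval, hψf]
  have hprod : f = ∏ j, (X - C (ψ j + β j)) := by
    refine eq_of_monic_of_dvd_of_natDegree_le (monic_prod_X_sub_C _ _) hfm hdvd ?_
    rw [hfd, natDegree_prod_of_monic _ _ fun j _ => monic_X_sub_C (ψ j + β j)]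
    simp only [natDegree_X_sub_C]
    simp
  have hres : resultant f g n k = ∏ i, g.eval (ψ i + β i) := by
    have := resultant_prod_left Finset.univ (fun j => X - C (ψ j + β j)) g k
      (by simp only [leadingCoeff_X_sub_C]; simp) hg
    rw [← hprod, hfd] at this
    rw [this]
    exact Finset.prod_congr rfl fun i _ => by
      rw [natDegree_X_sub_C, resultant_X_sub_C_left _ _ _ hg]
  rw [hres]
  exact Finset.prod_congr rfl fun i _ => by rw [← taylor_eval, hψe]

/-- The Sylvester matrix is affine in the parameter and has size `m + n`. -/
lemma natDegree_resultant_add_X_le {A : Type*} [CommRing A] (p q g : A[X]) (m n : ℕ) :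
    (resultant (p.map C + C X * q.map C) (g.map C) m n).natDegree ≤ m + n := by
  have : sylvester (p.map C + C X * q.map C) (g.map C) m n =
      (X : A[X]) • (sylvester q 0 m n).map C + (sylvester p g m n).map C := by
    ext1 i j
    induction j using Fin.addCases <;>
      · simp only [sylvester, Matrix.add_apply, Matrix.smul_apply, Matrix.map_apply, Matrix.of_apply,
          Fin.addCases_left, Fin.addCases_right]
        split_ifs <;> simp [add_comm]
  rw [resultant, this]
  simpa using natDegree_det_X_add_C_le (sylvester q 0 m n) (sylvester p g m n)

/-- The resultant of a monic polynomial `f` with `g`, expanded along the line from a product of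
distinct linear factors over a field to `f`. -/
theorem resultant_eq_sum_coeff_prod {F A : Type*} [Field F] [CommRing A] [Algebra F A]
    {n k M : ℕ} (hM : n + k < M) (α : Fin n ↪ F) (f g E : A[X])
    (hf : f = (∏ j, (X - C (α j))).map (algebraMap F A) + E)
    (hE : E.degree < n) (hg : g.natDegree ≤ k) (v : Fin n → PowerSeries F)
    (hv : ∀ i, ((∏ j ∈ Finset.univ.erase i, (X + C (α i - α j)) : F[X]) : PowerSeries F) * v i = 1) :
    resultant f g n k = ∑ l ∈ Finset.range M, (∏ i, ∑ m ∈ Finset.range M,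
      (-X) ^ m * (C (PowerSeries.coeff m ([
        ((taylor (algebraMap F A (α i)) g : A[X]) : PowerSeries A),
        (((derivative (taylor (α i) (∏ j, (X - C (α j))))).map (algebraMap F A) : A[X]) :
          PowerSeries A)] ++
        List.replicate m ((taylor (algebraMap F A (α i)) E : A[X]) : PowerSeries A) ++
        List.replicate (m + 1) ((v i).map (algebraMap F A))).prod) +
      X * C (PowerSeries.coeff m ([
        ((taylor (algebraMap F A (α i)) g : A[X]) : PowerSeries A),
        ((derivative (taylor (algebraMap F A (α i)) E) : A[X]) : PowerSeries A)] ++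
        List.replicate m ((taylor (algebraMap F A (α i)) E : A[X]) : PowerSeries A) ++
        List.replicate (m + 1) ((v i).map (algebraMap F A))).prod)) : A[X]).coeff l := by
  set p : F[X] := ∏ j, (X - C (α j)) with hp
  set G : A[X] := ∏ i : Fin n, _ with hG
  set R := resultant ((p.map (algebraMap F A)).map C + C X * E.map C) (g.map C) n k with hR
  have hev : (evalRingHom (1 : A)).comp C = RingHom.id A := by ext; simp
  have hR1 : R.eval 1 = resultant f g n k := by
    rw [hR, ← coe_evalRingHom, ← resultant_map_map]
    congr 1
    · rw [Polynomial.map_add, Polynomial.map_mul, map_map _ (evalRingHom 1),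
        map_map _ (evalRingHom 1), hev, hf]
      simp
    · rw [map_map, hev, map_id]
  have hRd : R.natDegree < M := (natDegree_resultant_add_X_le _ _ _ _ _).trans_lt hM
  rw [← hR1, eval_eq_sum_range' hRd]
  simp only [one_pow, mul_one]
  -- The outer variable `X` is the parameter `t`. `R` has degree below `M`, so agreement modulo `X ^
  -- M` fixes all its coefficients; `G` itself may have higher terms.
  suffices h : X ^ M ∣ R - G by
    refine Finset.sum_congr rfl fun l hl => ?_
    have := (X_pow_dvd_iff.mp h) l (Finset.mem_range.mp hl)
    rwa [coeff_sub, sub_eq_zero] at this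
  rw [← Ideal.mem_span_singleton, ← Ideal.Quotient.eq]
  let S := A[X] ⧸ Ideal.span {(X : A[X]) ^ M}
  let π : A[X] →+* S := Ideal.Quotient.mk _
  change π R = π G
  have ht : π X ^ M = 0 := by
    rw [← map_pow]
    exact Ideal.Quotient.eq_zero_iff_mem.mpr (Ideal.mem_span_singleton_self _)
  let σ : A →+* S := π.comp C
  let ρ : F →+* S := σ.comp (algebraMap F A)
  have hft : ((p.map (algebraMap F A)).map C + C X * E.map C).map π =
      ∏ j, (X - C (ρ (α j))) + C (π X) * E.map σ := by
    simp [hp, map_map, ρ, σ, Polynomial.map_prod]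
  have key := resultant_prod_add_C_mul ht (fun i => ρ (α i))
    (fun i j hij => by
      simp only [← map_sub]
      exact (sub_ne_zero.mpr (α.injective.ne hij)).isUnit.map ρ)
    (E.map σ) (g.map σ) (degree_map_le.trans_lt hE) (natDegree_map_le.trans hg)
    (fun i => (v i).map ρ) (fun i => by
      have := congrArg (PowerSeries.map ρ) (hv i)
      rw [map_mul, map_one, ← polynomial_map_coe, Polynomial.map_prod] at this
      simpa using this)
  have hπR : π R =
      resultant (∏ j, (X - C (ρ (α j))) + C (π X) * E.map σ) (g.map σ) n k := by
    rw [hR, ← resultant_map_map, hft, map_map]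
  rw [hπR, key, hG, map_prod]
  refine Finset.prod_congr rfl fun i _ => ?_
  rw [map_sum]
  refine Finset.sum_congr rfl fun m _ => ?_
  have hσ : ∀ P : PowerSeries A, π (C (PowerSeries.coeff m P)) = PowerSeries.coeff m (P.map σ) :=
    fun P => (PowerSeries.coeff_map σ m P).symm
  have hv' : ((v i).map (algebraMap F A)).map σ = (v i).map ρ := by
    ext; simp [ρ]
  have hE' : taylor (ρ (α i)) (E.map σ) = (taylor (algebraMap F A (α i)) E).map σ :=
    (map_taylor _ _ _).symm
  have hg' : taylor (ρ (α i)) (g.map σ) = (taylor (algebraMap F A (α i)) g).map σ :=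
    (map_taylor _ _ _).symm
  have hp' : taylor (ρ (α i)) (∏ j, (X - C (ρ (α j)))) =
      ((taylor (α i) p).map (algebraMap F A)).map σ := by
    rw [map_map, map_taylor, hp, Polynomial.map_prod]
    simp [ρ]
  rw [map_mul π, map_pow π, map_neg π, map_add π, map_mul π, hσ, hσ, hg', map_add (taylor _), hp',
    taylor_mul, taylor_C, hE', ← PowerSeries.coeff_C_mul m _ (π X), ← map_add (PowerSeries.coeff m)]
  congr 2
  -- `f_t' = p' + t E'` accounts for the two summands, whose series do not involve `t`.
  simp only [map_mul, List.prod_append, List.prod_cons, List.prod_nil, List.prod_replicate, mul_one,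
    map_pow, hv', ← polynomial_map_coe, derivative_add, derivative_C_mul, derivative_map, coe_add,
    coe_mul, coe_C]
  ring

end Polynomial

/-! ### Generic monic polynomials -/

open Polynomial in
lemma degree_monicOfCoeffs {R : Type*} [CommRing R] [Nontrivial R] {n : ℕ}
    (a : Fin n → R) : (monicOfCoeffs a).degree = n := by
  rw [monicOfCoeffs, degree_add_eq_left_of_degree_lt, degree_X_pow]
  rw [degree_X_pow]
  exact degree_sum_fin_lt a

open Polynomial in
lemma monic_monicOfCoeffs {R : Type*} [CommRing R] {n : ℕ} (a : Fin n → R) :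
    (monicOfCoeffs a).Monic :=
  monic_X_pow_add (degree_sum_fin_lt a)

lemma natDegree_monicOfCoeffs {R : Type*} [CommRing R] [Nontrivial R] {n : ℕ}
    (a : Fin n → R) : (monicOfCoeffs a).natDegree = n :=
  Polynomial.natDegree_eq_of_degree_eq_some (degree_monicOfCoeffs a)

lemma map_monicOfCoeffs {R S : Type*} [CommRing R] [CommRing S] (φ : R →+* S) {n : ℕ}
    (a : Fin n → R) : (monicOfCoeffs a).map φ = monicOfCoeffs fun i => φ (a i) := by
  simp [monicOfCoeffs, Polynomial.map_sum]

lemma monicOfCoeffs_coeff {R : Type*} [CommRing R] {f : Polynomial R} (hf : f.Monic) {n : ℕ}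
    (hn : f.natDegree = n) : (monicOfCoeffs fun i : Fin n => f.coeff i) = f := by
  subst hn
  conv_rhs => rw [hf.as_sum]
  rw [monicOfCoeffs, Fin.sum_univ_eq_sum_range
    (fun i => Polynomial.C (f.coeff i) * Polynomial.X ^ i)]

/-! ### Depth count for the resultant -/

namespace IsShallow

open Polynomial

variable {F : Type u} [Field F] {ι : Type v} {N Δ : ℕ}

/-- A shift by a constant is `F`-linear on coefficients, so each result is affine in the variables.
-/
lemma coeff_taylor (hN : 2 ≤ N) {n : ℕ} (hn : n ≤ N) (b : Fin n → ι) (q : F[X]) (a : F) (k : ℕ) :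
    IsShallow N 3 ((taylor (algebraMap F (MvPolynomial ι F) a)
      (∑ i : Fin n, C (MvPolynomial.X (b i)) * X ^ (i : ℕ) +
        q.map (algebraMap F (MvPolynomial ι F)))).coeff k) := by
  have h : ∀ i : ℕ, (X + C (algebraMap F (MvPolynomial ι F) a)) ^ i =
      ((X + C a) ^ i : F[X]).map (algebraMap F (MvPolynomial ι F)) := by simp
  rw [map_add, map_sum, ← map_taylor, coeff_add, finsetSum_coeff, coeff_map]
  simp only [taylor_mul, taylor_C, taylor_X_pow, coeff_C_mul, h, coeff_map]
  simp only [mul_comm (MvPolynomial.X _), MvPolynomial.algebraMap_eq]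
  exact add hN (sum_C_mul hN (by simpa using hn) _ fun i _ => .var 0 _) (.const _ _)

lemma coeff_derivative (hN : 2 ≤ N) {P : (MvPolynomial ι F)[X]} {k : ℕ}
    (hP : IsShallow N Δ (P.coeff (k + 1))) : IsShallow N (Δ + 1) ((derivative P).coeff k) := by
  rw [Polynomial.coeff_derivative, mul_comm]
  have := hP.C_mul hN ((k : F) + 1)
  simpa using this

lemma coeff_sum_neg_X_pow_mul (hN : 2 ≤ N) {M : ℕ} (hM : M ≤ N) {r s : ℕ → MvPolynomial ι F}
    (hr : ∀ m < M, IsShallow N Δ (r m)) (hs : ∀ m < M, IsShallow N Δ (s m)) (l : ℕ) :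
    IsShallow N (Δ + 3)
      ((∑ m ∈ Finset.range M, (-X) ^ m * (C (r m) + X * C (s m))).coeff l) := by
  rw [finsetSum_coeff]
  refine finset_sum (by simpa using hM) fun m hm => ?_
  have hm := Finset.mem_range.mp hm
  have h : ((-X) ^ m * (C (r m) + X * C (s m))).coeff l =
      MvPolynomial.C (((-X : F[X]) ^ m).coeff l) * r m +
        MvPolynomial.C (((-X : F[X]) ^ m * X).coeff l) * s m := by
    rw [mul_add, ← mul_assoc, coeff_add, coeff_mul_C, coeff_mul_C, mul_comm _ (r m),
      mul_comm _ (s m), mul_comm _ (r m), mul_comm _ (s m), ← coeff_map, ← coeff_map]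
    simp
  rw [h]
  exact add hN ((hr m hm).C_mul hN _) ((hs m hm).C_mul hN _)

/-- Over a field with enough elements, the resultant of two generic monic polynomials has a
formula of constant depth. -/
theorem resultant_monicOfCoeffs {d₁ d₂ : ℕ} (e : Fin N ↪ F)
    (hN : (2 * (d₁ + d₂ + 1) + 1) * (d₁ + d₂ + 1) < N) (b : Fin d₁ → ι) (b' : Fin d₂ → ι) :
    IsShallow N 18 (resultant
      (monicOfCoeffs fun i => (MvPolynomial.X (b i) : MvPolynomial ι F))
      (monicOfCoeffs fun i => (MvPolynomial.X (b' i) : MvPolynomial ι F))) := by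
  set M := d₁ + d₂ + 1 with hM
  have hMN : 2 * M + 1 ≤ N :=
    (Nat.le_mul_of_pos_right (2 * M + 1) (by omega : 0 < M)).trans hN.le
  have hN2 : 2 ≤ N := by omega
  set f := monicOfCoeffs fun i => (MvPolynomial.X (b i) : MvPolynomial ι F) with hf
  set g := monicOfCoeffs fun i => (MvPolynomial.X (b' i) : MvPolynomial ι F) with hg
  let α : Fin d₁ ↪ F := (Fin.castLEEmb (by omega)).trans e
  let p : F[X] := ∏ j, (X - C (α j))
  let E := ∑ i : Fin d₁, C (MvPolynomial.X (b i)) * X ^ (i : ℕ) +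
    (X ^ d₁ - p).map (algebraMap F (MvPolynomial ι F))
  have hfE : f = p.map (algebraMap F (MvPolynomial ι F)) + E := by
    simp only [f, E, monicOfCoeffs, Polynomial.map_sub, Polynomial.map_pow, map_X]
    ring
  have hE : E.degree < d₁ := by
    have hp : (p.map (algebraMap F (MvPolynomial ι F))).degree = d₁ := by
      rw [degree_map, degree_prod_of_monic _ _ fun j _ => monic_X_sub_C (α j)]
      simp
    have hpm : (p.map (algebraMap F (MvPolynomial ι F))).Monic :=
      (monic_prod_X_sub_C _ _).map _
    have hfd := degree_monicOfCoeffs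
      (fun i => (MvPolynomial.X (b i) : MvPolynomial ι F))
    rw [show E = f - p.map (algebraMap F (MvPolynomial ι F)) by rw [hfE]; ring, ← hfd]
    have hfm := monic_monicOfCoeffs (fun i => (MvPolynomial.X (b i) : MvPolynomial ι F))
    exact degree_sub_lt_left (hfd.trans hp.symm) hfm.ne_zero
      (hfm.leadingCoeff.trans hpm.leadingCoeff.symm)
  have hu : ∀ i, ∃ v : PowerSeries F,
      ((∏ j ∈ Finset.univ.erase i, (X + C (α i - α j)) : F[X]) : PowerSeries F) * v = 1 := by
    intro i
    refine IsUnit.exists_right_inv (PowerSeries.isUnit_iff_constantCoeff.mpr ?_)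
    rw [constantCoeff_coe, coeff_zero_eq_eval_zero, eval_prod, isUnit_iff_ne_zero,
      Finset.prod_ne_zero_iff]
    intro j hj
    simpa [sub_eq_zero] using (Finset.ne_of_mem_erase hj).symm
  choose v hv using hu
  rw [natDegree_monicOfCoeffs, natDegree_monicOfCoeffs,
    resultant_eq_sum_coeff_prod (M := M) (by omega) α f g E hfE hE
      (natDegree_monicOfCoeffs _).le v hv]
  -- The depth budget: 4 for the input series, 5 for a residue coefficient, 3 for the sum over `m`,
  -- 5 for the product over the roots, 1 for this sum.
  refine finset_sum (Δ := 17) (by simp; omega) fun l hl => ?_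
  have hEc : ∀ i k, IsShallow N 4 ((taylor (algebraMap F (MvPolynomial ι F) (α i)) E).coeff k) :=
    fun i k => (coeff_taylor hN2 (by omega) b _ _ k).succ
  have hgc : ∀ i k, IsShallow N 4 ((taylor (algebraMap F (MvPolynomial ι F) (α i)) g).coeff k) := by
    intro i k
    have := coeff_taylor hN2 (by omega) b' (X ^ d₂) (α i) k
    rw [Polynomial.map_pow, map_X, add_comm] at this
    exact this.succ
  have hprod : ∀ i, ∀ m < M, ∀ P : PowerSeries (MvPolynomial ι F),
      (∀ k, IsShallow N 4 (PowerSeries.coeff k P)) →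
      IsShallow N 9 (PowerSeries.coeff m ([
        ((taylor (algebraMap F (MvPolynomial ι F) (α i)) g : (MvPolynomial ι F)[X]) :
          PowerSeries (MvPolynomial ι F)), P] ++
        List.replicate m ((taylor (algebraMap F (MvPolynomial ι F) (α i)) E :
          (MvPolynomial ι F)[X]) : PowerSeries (MvPolynomial ι F)) ++
        List.replicate (m + 1) ((v i).map (algebraMap F (MvPolynomial ι F)))).prod) := by
    intro i m hm P hP
    refine coeff_list_prod (Δ := 4) hN2 e (M := M) (by omega) _ ?_ ?_ ?_ m hm
    · simp; omega
    -- The list has `2 * m + 3 ≤ 2 * M + 1` factors, the source of the first factor in `hN`.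
    · refine lt_of_le_of_lt (Nat.mul_le_mul_right _ ?_) hN
      simp; omega
    · intro Q hQ k _
      simp only [List.cons_append, List.nil_append, List.mem_cons, List.mem_append,
        List.mem_replicate] at hQ
      obtain rfl | rfl | ⟨-, rfl⟩ | ⟨-, rfl⟩ := hQ
      · rw [coeff_coe]; exact hgc i k
      · exact hP k
      · rw [coeff_coe]; exact hEc i k
      · rw [PowerSeries.coeff_map]; exact .const _ _
  rw [← coeff_coe, ← coeToPowerSeries.ringHom_apply, map_prod, ← Finset.prod_map_toList]
  refine coeff_list_prod (Δ := 12) hN2 e (M := M) (by omega) _ (by simp; omega) ?_ ?_ l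
    (Finset.mem_range.mp hl)
  · refine lt_of_le_of_lt (Nat.mul_le_mul_right _ ?_) hN
    simp; omega
  · simp only [List.mem_map]
    rintro _ ⟨i, -, rfl⟩ k -
    rw [coeToPowerSeries.ringHom_apply, coeff_coe]
    refine coeff_sum_neg_X_pow_mul (Δ := 9) hN2 (by omega) (fun m hm => hprod i m hm _ fun k => ?_)
      (fun m hm => hprod i m hm _ fun k => ?_) k
    · rw [coeff_coe, coeff_map]; exact .const _ _
    · rw [coeff_coe]
      exact coeff_derivative hN2 (coeff_taylor hN2 (by omega) b _ _ _)

/-- For `d ≤ 1` the bound `d ^ c` on the field size guarantees no interpolation nodes, so these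
resultants, `1` or a difference of two variables, are written out. -/
lemma resultant_monicOfCoeffs_of_le_one {d₁ d₂ : ℕ} (hN : 2 ≤ N) (h₁ : d₁ ≤ 1) (h₂ : d₂ ≤ 1)
    (b : Fin d₁ → ι) (b' : Fin d₂ → ι) :
    IsShallow N 18 (resultant
      (monicOfCoeffs fun i => (MvPolynomial.X (b i) : MvPolynomial ι F))
      (monicOfCoeffs fun i => (MvPolynomial.X (b' i) : MvPolynomial ι F))) := by
  have hone : IsShallow N 18 (1 : MvPolynomial ι F) := by
    simpa using IsShallow.const (N := N) (ι := ι) 18 (1 : F)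
  rw [natDegree_monicOfCoeffs, natDegree_monicOfCoeffs]
  interval_cases d₁
  · simpa [monicOfCoeffs] using hone
  · interval_cases d₂
    · simpa [monicOfCoeffs] using hone
    · have h : ∀ c : Fin 1 → ι, (monicOfCoeffs fun i => (MvPolynomial.X (c i) : MvPolynomial ι F)) =
          X + C (MvPolynomial.X (c 0)) := fun c => by simp [monicOfCoeffs]
      have h' := natDegree_monicOfCoeffs fun i => (MvPolynomial.X (b' i) : MvPolynomial ι F)
      rw [h b, resultant_X_add_C_left _ _ _ h'.le, h b']
      have := (add hN ((IsShallow.var 0 (b 0)).C_mul hN (-1 : F)) (.var _ (b' 0))).mono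
        (show 2 ≤ 18 by norm_num)
      simpa using this

end IsShallow

/-! ### Choice of constants and conclusion -/

lemma nonempty_embedding_of_le_card {F : Type*} {n : ℕ} (h : (n : ℕ∞) ≤ ENat.card F) :
    Nonempty (Fin n ↪ F) := by
  cases finite_or_infinite F
  · have := Fintype.ofFinite F
    rw [ENat.card_eq_coe_fintype_card, Nat.cast_le] at h
    exact Function.Embedding.nonempty_of_card_le (by simpa using h)
  · exact ⟨Fin.valEmbedding.trans (Infinite.natEmbedding F)⟩

theorem mainTheorem5 :
    ∃ (c : ℕ) (Δ : ℕ) (p : Polynomial ℕ), 0 < c ∧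
      ∀ (F : Type u) [Field F] (d d₁ d₂ : ℕ), d₁ ≤ d → d₂ ≤ d →
        ((d ^ c : ℕ) : ℕ∞) ≤ ENat.card F →
        ∃ C : AlgCircuit F (Fin d₁ ⊕ Fin d₂),
          C.size ≤ p.eval d ∧
          C.depth ≤ Δ ∧
          -- the circuit computes the resultant of the two generic monic polynomials, formally
          C.toMvPolynomial =
            Polynomial.resultant
              (monicOfCoeffs fun i : Fin d₁ =>
                (MvPolynomial.X (Sum.inl i) : MvPolynomial (Fin d₁ ⊕ Fin d₂) F))
              (monicOfCoeffs fun j : Fin d₂ =>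
                (MvPolynomial.X (Sum.inr j) : MvPolynomial (Fin d₁ ⊕ Fin d₂) F)) ∧
          -- hence on the coefficients of any two monic polynomials it outputs their resultant
          ∀ f g : Polynomial F, f.Monic → g.Monic → f.natDegree = d₁ → g.natDegree = d₂ →
            C.eval (Sum.elim (fun i : Fin d₁ => f.coeff i) (fun j : Fin d₂ => g.coeff j)) =
              Polynomial.resultant f g := by
  -- With `M ≤ 2 * d + 1`, this fan-in exceeds `(2 * M + 1) * M`. The exponent 6 makes `d ^ 6` at
  -- least the fan-in for `d ≥ 2`; at `d = 2` this reads `56 ≤ 64`.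
  refine ⟨6, 18, shallowSize ((4 * Polynomial.X + 3) * (2 * Polynomial.X + 1) + 1) 18, by norm_num,
    fun F _ d d₁ d₂ h₁ h₂ hF => ?_⟩
  have hshallow : IsShallow ((4 * d + 3) * (2 * d + 1) + 1) 18 (Polynomial.resultant
      (monicOfCoeffs fun i : Fin d₁ =>
        (MvPolynomial.X (Sum.inl i) : MvPolynomial (Fin d₁ ⊕ Fin d₂) F))
      (monicOfCoeffs fun j : Fin d₂ =>
        (MvPolynomial.X (Sum.inr j) : MvPolynomial (Fin d₁ ⊕ Fin d₂) F))) := by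
    rcases le_or_gt d 1 with hd | hd
    · exact IsShallow.resultant_monicOfCoeffs_of_le_one (by nlinarith) (h₁.trans hd) (h₂.trans hd)
        _ _
    · have hle : (4 * d + 3) * (2 * d + 1) + 1 ≤ d ^ 6 := by
        have h4 : 2 ^ 4 ≤ d ^ 4 := Nat.pow_le_pow_left hd 4
        have h6 := Nat.mul_le_mul_right (d ^ 2) h4
        rw [← pow_add] at h6
        nlinarith
      obtain ⟨e⟩ := nonempty_embedding_of_le_card ((Nat.cast_le.mpr hle).trans hF)
      refine IsShallow.resultant_monicOfCoeffs e ?_ _ _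
      exact Nat.lt_succ_of_le (Nat.mul_le_mul (by omega) (by omega))
  obtain ⟨C, hs, hd, hC⟩ := AlgCircuit.exists_of_isShallow hshallow
  refine ⟨C, by simpa [eval_shallowSize] using hs, hd, hC, fun f g hf hg hfd hgd => ?_⟩
  -- Specialization commutes with the resultant once the Sylvester size is fixed; the default
  -- `natDegree` arguments become `d₁`, `d₂`.
  rw [AlgCircuit.eval_eq_aeval_toMvPolynomial, hC, ← AlgHom.coe_toRingHom,
    ← Polynomial.resultant_map_map, natDegree_monicOfCoeffs, natDegree_monicOfCoeffs,
    map_monicOfCoeffs, map_monicOfCoeffs]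
  refine (congrArg₂ (fun p q => Polynomial.resultant p q d₁ d₂)
    ((congrArg monicOfCoeffs (funext fun i => ?_)).trans (monicOfCoeffs_coeff hf hfd))
    ((congrArg monicOfCoeffs (funext fun j => ?_)).trans (monicOfCoeffs_coeff hg hgd))).trans
    (by rw [hfd, hgd])
  · exact MvPolynomial.aeval_X _ (Sum.inl i)
  · exact MvPolynomial.aeval_X _ (Sum.inr j)
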